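/- Let $P$ be a finite normal program over a propositional language, i.e. a finite set of rules $a\leftarrow b_1,\dots,b_m,\mathsf{not}\,c_1,\dots,\mathsf{not}\,c_n$ (atoms $a,b_j,c_j$). A literal is an atom $\phi$ or its negation $\neg\phi$; a set of literals is consistent if it contains no complementary pair. **Partial stable models.** For a set $S$ of default negations let $F_P(S)=\{\mathsf{not}\,a : P\cup S\nvdash a\}$, where $\mathsf{not}\,a$ is treated as a named atom. A partial stable model of $P$ is a set $M$ of literals for which there is an $S$ with $F_P(F_P(S))=S\subseteq F_P(S)$ such that, for each atom $\xi$, $\neg\xi\in M$ iff $\mathsf{not}\,\xi\in S$, and $\xi\in M$ iff $P\cup S\vdash\xi$. **Goals.** Goals are built by $\wedge,\vee$ from $F$, from expressions $T(C)$ with $C$ a set of literals (a context), and from literals. Each occurrence of a literal $g_n$ in a goal obtained from an initial literal $g_1$ has a unique rewrite chain $g_1\prec\dots\prec g_n$, in which $g_{j+1}$ was introduced by rewriting $g_j$. The occurrence is a loop literal if for some $i<n$ the segment $g_i\prec\dots\prec g_n$ is a loop: an odd loop if $g_i$ and $g_n$ are complementary; if $g_i=g_n$, a positive loop if all literals of the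 segment are atoms, a negative loop if all are negative, and an even loop otherwise. **The system $R^0$.** A rewrite step of $R^0$ applies one of the following to a subformula. (1) Literal rewriting at a non-loop literal: if $B_1,\dots,B_k$ are the bodies of the rules of $P$ with head $\phi$ ($\mathsf{not}$ read as $\neg$, the empty body as $T$, and $k=0$ giving $F$), then $\phi\to B_1\vee\dots\vee B_k$ and $\neg\phi\to\neg B_1\wedge\dots\wedge\neg B_k$, with negations pushed to the atoms; here $\neg T$ is replaced by $F$, and $T$ and $\neg F$ by $T(C)$ with $C$ the set of literals on the chain up to and including the literal rewritten. (2) Simplification: $F\vee\Phi\to\Phi$; $\Phi\vee F\to\Phi$; $F\wedge\Phi\to F$; $\Phi\wedge F\to F$; $T(C_1)\wedge T(C_2)\to T(C_1\cup C_2)$ if $C_1\cup C_2$ is consistent, and $\to F$ if it is not; $\Phi_1\wedge(\Phi_2\vee\Phi_3)\to(\Phi_1\wedge\Phi_2)\vee(\Phi_1\wedge\Phi_3)$; $(\Phi_1\vee\Phi_2)\wedge\Phi_3\to(\Phi_1\wedge\Phi_3)\vee(\Phi_2\wedge\Phi_3)$. (3) Loop rules, at a loop literal with chain $g_1\prec\dots\prec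 g_n$: $g_n\to F$ if some segment $g_i\prec\dots\prec g_n$ is a positive or an odd loop; $g_n\to T(\{g_1,\dots,g_n\})$ if some such segment is a negative or an even loop. **Recycling.** A computed rule for a literal $p$ on a system $R$ is $p\to E$, where $E$ is a normal form $F$ or $T(D_1)\vee\dots\vee T(D_k)$ to which $p$, as initial goal, can be rewritten in $R$. In a system in which the literal rewrite rule of $p$ has been replaced by this computed rule, a non-loop occurrence of $p$ with chain $g_1\prec\dots\prec g_n=p$ is rewritten by the recycling rule RC: with $G=\{g_1,\dots,g_n\}$, $p$ is replaced by the disjunction of the $T(G\cup D_j)$ over those $j$ for which $G\cup D_j$ is consistent (by $F$ if there is none, or if $E=F$). Let $R^0,R^1,R^2,\dots$ be any sequence of systems, starting with $R^0$ above, in which $R^{i+1}$ is obtained from $R^i$ by replacing the literal rewrite rules of the literals in some set by computed rules for them on $R^i$. **Theorem.** For every $i\ge0$, $R^i$ is sound and complete, that is: *Soundness:* for every literal $g$, every rewrite sequence of $R^i$ from $g$ to a goal $T(C_1)\vee\dots\vee T(C_n)$ and every $j\in\{1,\dots,n\}$, there is a partial stable model $M$ of $P$ with $g\in C_j\subseteq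 M$. *Completeness:* for every partial stable model $M$ of $P$ and every literal $g\in M$, there is a rewrite sequence of $R^i$ from $g$ to a goal $T(C_1)\vee\dots\vee T(C_n)$ with $g\in C_j\subseteq M$ for some $j\in\{1,\dots,n\}$. -/

import Mathlib

namespace LP

/-- A literal over the atoms `α`: an atom or its negation. -/
inductive Literal (α : Type*) where
  | pos (a : α)
  | neg (a : α)

/-- The complementary literal. -/
def Literal.compl {α : Type*} : Literal α → Literal α
  | .pos a => .neg a
  | .neg a => .pos a

/-- The literal is an atom. -/
def Literal.IsPos {α : Type*} (l : Literal α) : Prop := ∃ a, l = .pos a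

/-- The literal is a negated atom. -/
def Literal.IsNeg {α : Type*} (l : Literal α) : Prop := ∃ a, l = .neg a

/-- The rule `head ← b₁, …, bₘ, not c₁, …, not cₙ`. -/
structure Rule (α : Type*) where
  head : α
  /-- the atoms `b₁, …, bₘ` -/
  posBody : List α
  /-- the atoms `c₁, …, cₙ` -/
  negBody : List α

/-- A normal program is a finite set of rules. -/
abbrev Program (α : Type*) := Finset (Rule α)

/-! ### Partial stable models (alternating fixpoints) -/

/-- `P ∪ S ⊢ a`, where the set `S` of atoms stands for the default negations `not b`, `b ∈ S`,
each regarded as a named atom. -/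
inductive Derives {α : Type*} (P : Program α) (S : Set α) : α → Prop where
  | rule (r : Rule α) (hr : r ∈ P) (hpos : ∀ b ∈ r.posBody, Derives P S b)
      (hneg : ∀ c ∈ r.negBody, c ∈ S) : Derives P S r.head

/-- The function `F_P(S) = {not a | P ∪ S ⊬ a}` on sets of default negations. -/
def altOp {α : Type*} (P : Program α) (S : Set α) : Set α := {a | ¬ Derives P S a}

/-- `M` is a partial stable model of `P`, given as the set of literals true in it. -/
def IsPartialStableModel {α : Type*} (P : Program α) (M : Set (Literal α)) : Prop :=
  ∃ S : Set α, altOp P (altOp P S) = S ∧ S ⊆ altOp P S ∧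
    ∀ a : α, (.pos a ∈ M ↔ Derives P S a) ∧ (.neg a ∈ M ↔ a ∈ S)

/-! ### Clark completion -/

/-- Propositional formulas. -/
inductive Fml (α : Type*) where
  | fls
  | tru
  | atom (a : α)
  | neg (φ : Fml α)
  | and (φ ψ : Fml α)
  | or (φ ψ : Fml α)

/-- The conjunction of a list of formulas (`T` if it is empty). -/
def Fml.conj {α : Type*} : List (Fml α) → Fml α
  | [] => .tru
  | [φ] => φ
  | φ :: ψ :: L => .and φ (Fml.conj (ψ :: L))

/-- The disjunction of a list of formulas (`F` if it is empty). -/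
def Fml.disj {α : Type*} : List (Fml α) → Fml α
  | [] => .fls
  | [φ] => φ
  | φ :: ψ :: L => .or φ (Fml.disj (ψ :: L))

/-- The body of a rule as a formula, with default negations replaced by negative literals. -/
def Rule.body {α : Type*} (r : Rule α) : Fml α :=
  Fml.conj (r.posBody.map .atom ++ r.negBody.map fun c => .neg (.atom c))

open Classical in
/-- The right-hand side `B₁ ∨ … ∨ Bₙ` of the completed definition of the atom `a`. -/
noncomputable def completion {α : Type*} (P : Program α) (a : α) : Fml α :=
  Fml.disj ((P.filter fun r => r.head = a).toList.map Rule.body)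

/-! ### Goals -/

/-- A set of literals is consistent if it contains no complementary pair. -/
def Consistent {α : Type*} (C : Set (Literal α)) : Prop :=
  ∀ a : α, ¬ (.pos a ∈ C ∧ .neg a ∈ C)

/-- Goal formulas with negation only in front of atoms. Every occurrence of a literal `l` carries
the list `anc = [g₁, …, gₙ₋₁]` of its ancestors, so that its rewrite chain is
`g₁ ≺ … ≺ gₙ₋₁ ≺ l`, that is, `anc ++ [l]`. The goal `tru C` is `T(C)`. -/
inductive Goal (α : Type*) where
  | fls
  | tru (C : Set (Literal α))
  | lit (anc : List (Literal α)) (l : Literal α)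
  | and (Φ Ψ : Goal α)
  | or (Φ Ψ : Goal α)

/-- The disjunction of a list of goals (`F` if it is empty). -/
def Goal.disj {α : Type*} : List (Goal α) → Goal α
  | [] => .fls
  | [Φ] => Φ
  | Φ :: Ψ :: L => .or Φ (Goal.disj (Ψ :: L))

/-- The set of literals on a rewrite chain. -/
def chainSet {α : Type*} (chain : List (Literal α)) : Set (Literal α) := {l | l ∈ chain}

/-- The goal derived at the end of the rewrite chain `chain` from the formula `φ` (if the sign is
`true`) or from `¬ φ` (if the sign is `false`). Negations are pushed to the atoms,
`T` and `¬ F` become `T(C)` with `C` the set of literals on the chain, and `¬ T` becomes `F`. -/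
def Goal.ofFml {α : Type*} (chain : List (Literal α)) : Bool → Fml α → Goal α
  | true, .fls => .fls
  | false, .fls => .tru (chainSet chain)
  | true, .tru => .tru (chainSet chain)
  | false, .tru => .fls
  | true, .atom a => .lit chain (.pos a)
  | false, .atom a => .lit chain (.neg a)
  | true, .neg φ => Goal.ofFml chain false φ
  | false, .neg φ => Goal.ofFml chain true φ
  | true, .and φ ψ => .and (Goal.ofFml chain true φ) (Goal.ofFml chain true ψ)
  | false, .and φ ψ => .or (Goal.ofFml chain false φ) (Goal.ofFml chain false ψ)
  | true, .or φ ψ => .or (Goal.ofFml chain true φ) (Goal.ofFml chain true ψ)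
  | false, .or φ ψ => .and (Goal.ofFml chain false φ) (Goal.ofFml chain false ψ)

/-- `Q.IsDisjOfT Cs`: the goal `Q` is `T(C₁) ∨ … ∨ T(Cₙ)`, `n ≥ 1`, up to bracketing, where
`Cs = [C₁, …, Cₙ]`. -/
inductive Goal.IsDisjOfT {α : Type*} : Goal α → List (Set (Literal α)) → Prop where
  | tru (C : Set (Literal α)) : Goal.IsDisjOfT (.tru C) [C]
  | or {Φ Ψ : Goal α} {Cs Ds : List (Set (Literal α))} (hΦ : Goal.IsDisjOfT Φ Cs)
      (hΨ : Goal.IsDisjOfT Ψ Ds) : Goal.IsDisjOfT (.or Φ Ψ) (Cs ++ Ds)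

/-! ### Loops -/

/-- The chain is an odd loop: its ends are complementary. -/
def IsOddLoop {α : Type*} (S : List (Literal α)) : Prop :=
  ∃ (l : Literal α) (θ : List (Literal α)), S = l :: (θ ++ [l.compl])

/-- The chain `l₁ ≺⁺ lₙ` has equal ends. -/
def ReturnsToStart {α : Type*} (S : List (Literal α)) : Prop :=
  ∃ (l : Literal α) (θ : List (Literal α)), S = l :: (θ ++ [l])

/-- The chain is a positive loop. -/
def IsPositiveLoop {α : Type*} (S : List (Literal α)) : Prop :=
  ReturnsToStart S ∧ ∀ l ∈ S, l.IsPos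

/-- The chain is a negative loop. -/
def IsNegativeLoop {α : Type*} (S : List (Literal α)) : Prop :=
  ReturnsToStart S ∧ ∀ l ∈ S, l.IsNeg

/-- The chain is an even loop. -/
def IsEvenLoop {α : Type*} (S : List (Literal α)) : Prop :=
  ReturnsToStart S ∧ ¬ IsPositiveLoop S ∧ ¬ IsNegativeLoop S

/-- Some final segment `gᵢ ≺⁺ gₙ` of the chain is a positive loop or an odd loop. -/
def EndsInFailingLoop {α : Type*} (chain : List (Literal α)) : Prop :=
  ∃ S, S <:+ chain ∧ (IsPositiveLoop S ∨ IsOddLoop S)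

/-- Some final segment `gᵢ ≺⁺ gₙ` of the chain is a negative loop or an even loop. -/
def EndsInSucceedingLoop {α : Type*} (chain : List (Literal α)) : Prop :=
  ∃ S, S <:+ chain ∧ (IsNegativeLoop S ∨ IsEvenLoop S)

/-- The last literal of the chain is a loop literal. -/
def EndsInLoop {α : Type*} (chain : List (Literal α)) : Prop :=
  EndsInFailingLoop chain ∨ EndsInSucceedingLoop chain

/-! ### Rewrite systems -/

/-- The right-hand side of the literal rewrite rule of a literal. -/
inductive LiteralRule (α : Type*) where
  /-- a program rule, with the formula to which the literal is rewritten -/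
  | program (φ : Fml α)
  /-- a computed rule with right-hand side `T(D₁) ∨ … ∨ T(Dₖ)`, or `F` if `k = 0` -/
  | computed (Ds : List (Set (Literal α)))

/-- A goal rewrite system is given by its literal rewrite rules, one for each literal; the
simplification rules, the loop rules and the recycling rule are common to all systems. -/
abbrev RewriteSystem (α : Type*) := Literal α → LiteralRule α

open Classical in
/-- The right-hand side of the recycling rule: `D₁, …, Dₖ` are the contexts of the computed rule
for the last literal of the rewrite chain. -/
noncomputable def recycled {α : Type*} (chain : List (Literal α))
    (Ds : List (Set (Literal α))) : Goal α :=
  Goal.disj ((Ds.filter fun D => Consistent (D ∪ chainSet chain)).map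
    fun D => .tru (chainSet chain ∪ D))

/-- One rewrite step. -/
inductive Step {α : Type*} (R : RewriteSystem α) : Goal α → Goal α → Prop where
  | program {anc : List (Literal α)} {l : Literal α} {φ : Fml α}
      (hloop : ¬ EndsInLoop (anc ++ [l])) (hR : R l = .program φ) :
      Step R (.lit anc l) (Goal.ofFml (anc ++ [l]) true φ)
  | rc {anc : List (Literal α)} {l : Literal α} {Ds : List (Set (Literal α))}
      (hloop : ¬ EndsInLoop (anc ++ [l])) (hR : R l = .computed Ds) :
      Step R (.lit anc l) (recycled (anc ++ [l]) Ds)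
  | lr1 {anc : List (Literal α)} {l : Literal α} (h : EndsInFailingLoop (anc ++ [l])) :
      Step R (.lit anc l) .fls
  | lr2 {anc : List (Literal α)} {l : Literal α} (h : EndsInSucceedingLoop (anc ++ [l])) :
      Step R (.lit anc l) (.tru (chainSet (anc ++ [l])))
  | sr1 (Φ : Goal α) : Step R (.or .fls Φ) Φ
  | sr1' (Φ : Goal α) : Step R (.or Φ .fls) Φ
  | sr2 (Φ : Goal α) : Step R (.and .fls Φ) .fls
  | sr2' (Φ : Goal α) : Step R (.and Φ .fls) .fls
  | sr3 {C D : Set (Literal α)} (h : Consistent (C ∪ D)) :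
      Step R (.and (.tru C) (.tru D)) (.tru (C ∪ D))
  | sr4 {C D : Set (Literal α)} (h : ¬ Consistent (C ∪ D)) :
      Step R (.and (.tru C) (.tru D)) .fls
  | sr5 (Φ Ψ Χ : Goal α) : Step R (.and Φ (.or Ψ Χ)) (.or (.and Φ Ψ) (.and Φ Χ))
  | sr5' (Φ Ψ Χ : Goal α) : Step R (.and (.or Φ Ψ) Χ) (.or (.and Φ Χ) (.and Ψ Χ))
  | andLeft {Φ Φ' : Goal α} (Ψ : Goal α) (h : Step R Φ Φ') : Step R (.and Φ Ψ) (.and Φ' Ψ)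
  | andRight (Φ : Goal α) {Ψ Ψ' : Goal α} (h : Step R Ψ Ψ') : Step R (.and Φ Ψ) (.and Φ Ψ')
  | orLeft {Φ Φ' : Goal α} (Ψ : Goal α) (h : Step R Φ Φ') : Step R (.or Φ Ψ) (.or Φ' Ψ)
  | orRight (Φ : Goal α) {Ψ Ψ' : Goal α} (h : Step R Ψ Ψ') : Step R (.or Φ Ψ) (.or Φ Ψ')

/-- There is a rewrite sequence of `R` from the literal `g`, as initial goal, to `Q`. -/
def Rewrites {α : Type*} (R : RewriteSystem α) (g : Literal α) (Q : Goal α) : Prop :=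
  Relation.ReflTransGen (Step R) (.lit [] g) Q

/-- The system `R⁰` of `P`: an atom `a` is rewritten to its completed definition, and `¬ a` to the
negation of it. -/
noncomputable def initialSystem {α : Type*} (P : Program α) : RewriteSystem α
  | .pos a => .program (completion P a)
  | .neg a => .program (.neg (completion P a))

/-- `Ds` is the right-hand side of a computed rule for `p` on `R`: either `p` is rewritten to `F`
and `Ds` is empty, or `p` is rewritten to `T(D₁) ∨ … ∨ T(Dₖ)` and `Ds = [D₁, …, Dₖ]`. -/
def IsComputedRule {α : Type*} (R : RewriteSystem α) (p : Literal α)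
    (Ds : List (Set (Literal α))) : Prop :=
  (Rewrites R p .fls ∧ Ds = []) ∨ ∃ Q : Goal α, Rewrites R p Q ∧ Q.IsDisjOfT Ds

/-- `R'` is obtained from `R` by replacing the rewrite rules of the literals of some set `L` by
rules computed on `R`. -/
def IsRecyclingOf {α : Type*} (R R' : RewriteSystem α) : Prop :=
  ∃ L : Set (Literal α),
    (∀ p ∈ L, ∃ Ds, IsComputedRule R p Ds ∧ R' p = .computed Ds) ∧ ∀ p ∉ L, R' p = R p

/-- Soundness with respect to the partial stable models of `P`. -/
def IsSound {α : Type*} (P : Program α) (R : RewriteSystem α) : Prop :=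
  ∀ (g : Literal α) (Q : Goal α) (Cs : List (Set (Literal α))),
    Rewrites R g Q → Q.IsDisjOfT Cs →
      ∀ C ∈ Cs, ∃ M, IsPartialStableModel P M ∧ g ∈ C ∧ C ⊆ M

/-- Completeness with respect to the partial stable models of `P`. -/
def IsComplete {α : Type*} (P : Program α) (R : RewriteSystem α) : Prop :=
  ∀ (g : Literal α) (M : Set (Literal α)), IsPartialStableModel P M → g ∈ M →
    ∃ (Q : Goal α) (Cs : List (Set (Literal α))),
      Rewrites R g Q ∧ Q.IsDisjOfT Cs ∧ ∃ C ∈ Cs, g ∈ C ∧ C ⊆ M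

end LP

/-!
Both halves hold for every rewrite system each of whose literal rules is either the rule of `R⁰` or
a computed rule whose contexts are justified and cover the partial stable models (`Faithful`), and
recycling preserves this property because both halves speak about *all* rewrite sequences.

Soundness. Read a goal as the set of contexts of its disjunctive normal form (`Goal.Answers`), where
a literal occurrence stands for the contexts that are justified relative to its chain (`Admits`):
negative literals are blocked, and atoms are derivable from the negative literals of the context and
the atoms of the chain. Rewriting reflects answers (`Step.answers`). The delicate point is that
justifications stay well-founded when an atom on the chain is discharged: an atom closed by an even
loop has a negative literal between it and its earlier occurrence, so the derivation of an atom never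
uses an atom of the chain that only atoms separate from it (`Guarded`). For the empty chain, a justified
context is consistent, its negative part is a post-fixpoint of `F_P²`, and the least fixpoint above
it is a partial stable model (`Justified.exists_partialStableModel`).

Completeness. Given a partial stable model `M`, rank its atoms by the height of their derivations and
call a literal occurrence true if its chain lies in `M` and ranks decrease from atom to atom. Such a
chain has neither odd nor positive loops, so rewriting preserves truth of goals
(`Faithful.exists_rank_holds`), and every normal form of `g ∈ M` has a context inside `M`. A normal
form exists because loop-free chains have no repetitions and only finitely many literals can occur
(`Faithful.normalizes_lit`).
-/

namespace LP

variable {α : Type*}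

theorem chainSet_append_singleton (anc : List (Literal α)) (l : Literal α) :
    chainSet (anc ++ [l]) = chainSet anc ∪ {l} := by
  ext x; simp [chainSet, or_comm]

theorem Consistent.mono {C D : Set (Literal α)} (h : Consistent D) (hCD : C ⊆ D) :
    Consistent C := fun a ha => h a ⟨hCD ha.1, hCD ha.2⟩

/-! ### Partial stable models from justified contexts -/

theorem Derives.mono {P : Program α} {S T : Set α} (hST : S ⊆ T) {a : α}
    (h : Derives P S a) : Derives P T a := by
  induction h with
  | rule r hr _ hneg ih => exact .rule r hr ih fun c hc => hST (hneg c hc)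

theorem altOp_antitone (P : Program α) : Antitone (altOp P) :=
  fun _ _ hST _ ha hS => ha (hS.mono hST)

/-- The least fixpoint of `F_P²` above `S₀` is coherent because `F_P(S₀)` is a pre-fixpoint of
`F_P²` above `S₀`, so that it contains the least one. -/
theorem exists_altOp_fixpoint (P : Program α) {S₀ : Set α} (h₁ : S₀ ⊆ altOp P S₀)
    (h₂ : S₀ ⊆ altOp P (altOp P S₀)) :
    ∃ S, S₀ ⊆ S ∧ altOp P (altOp P S) = S ∧ S ⊆ altOp P S := by
  have anti := altOp_antitone P
  let f : Set α →o Set α :=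
    ⟨fun X => S₀ ∪ altOp P (altOp P X), fun X Y h => Set.union_subset_union_right _ (anti (anti h))⟩
  have hfix : S₀ ∪ altOp P (altOp P f.lfp) = f.lfp := f.map_lfp
  have hS₀ : S₀ ⊆ f.lfp := fun x hx => hfix ▸ Or.inl hx
  have hfix' : altOp P (altOp P f.lfp) = f.lfp := by
    rw [Set.union_eq_self_of_subset_left (h₂.trans (anti (anti hS₀)))] at hfix
    exact hfix
  have hle : f.lfp ⊆ altOp P S₀ := f.lfp_le (Set.union_subset h₁ (anti h₂))
  refine ⟨f.lfp, hS₀, hfix', f.lfp_le (Set.union_subset (h₂.trans (anti hle)) ?_)⟩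
  exact (congrArg (altOp P) hfix').subset

/-- Derivability from the default negations in `S` together with the atoms in `A` as facts. -/
inductive DerivesFrom (P : Program α) (S A : Set α) : α → Prop where
  | fact {a : α} (ha : a ∈ A) : DerivesFrom P S A a
  | rule (r : Rule α) (hr : r ∈ P) (hpos : ∀ b ∈ r.posBody, DerivesFrom P S A b)
      (hneg : ∀ c ∈ r.negBody, c ∈ S) : DerivesFrom P S A r.head

theorem DerivesFrom.trans {P : Program α} {S T A B : Set α} (hST : S ⊆ T)
    (hAB : ∀ a ∈ A, DerivesFrom P T B a) {a : α} (h : DerivesFrom P S A a) :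
    DerivesFrom P T B a := by
  induction h with
  | fact ha => exact hAB _ ha
  | rule r hr _ hneg ih => exact .rule r hr ih fun c hc => hST (hneg c hc)

theorem DerivesFrom.mono {P : Program α} {S T A B : Set α} (hST : S ⊆ T) (hAB : A ⊆ B) {a : α}
    (h : DerivesFrom P S A a) : DerivesFrom P T B a :=
  h.trans hST fun _ ha => .fact (hAB ha)

theorem DerivesFrom.derives {P : Program α} {S : Set α} {a : α} (h : DerivesFrom P S ∅ a) :
    Derives P S a := by
  induction h with
  | fact ha => exact ha.elim
  | rule r hr _ hneg ih => exact .rule r hr ih hneg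

/-- The atoms that occur negatively in `C`. -/
def negAtoms (C : Set (Literal α)) : Set α := {a | .neg a ∈ C}

theorem negAtoms_mono {C D : Set (Literal α)} (h : C ⊆ D) : negAtoms C ⊆ negAtoms D :=
  fun _ ha => h ha

/-- Every rule for the atom `a` has a body literal whose complement is in `C`. -/
def Blocked (P : Program α) (C : Set (Literal α)) (a : α) : Prop :=
  ∀ r ∈ P, r.head = a → (∃ b ∈ r.posBody, .neg b ∈ C) ∨ ∃ c ∈ r.negBody, .pos c ∈ C

theorem Blocked.mono {P : Program α} {C D : Set (Literal α)} {a : α} (h : Blocked P C a)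
    (hCD : C ⊆ D) : Blocked P D a := fun r hr ha =>
  (h r hr ha).imp (fun ⟨b, hb, hC⟩ => ⟨b, hb, hCD hC⟩) fun ⟨c, hc, hC⟩ => ⟨c, hc, hCD hC⟩

/-- The context `C` is justified relative to the rewrite chain `chain`: it is consistent, contains
the chain, its negative literals off the chain are blocked, and its atoms are derivable from its
negative literals and the atoms of the chain. -/
structure Justified (P : Program α) (chain : List (Literal α)) (C : Set (Literal α)) : Prop where
  consistent : Consistent C
  chain_subset : chainSet chain ⊆ C
  blocked : ∀ a, .neg a ∈ C → .neg a ∈ chain ∨ Blocked P C a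
  derivesFrom : ∀ a, .pos a ∈ C → DerivesFrom P (negAtoms C) {b | .pos b ∈ chain} a

theorem Justified.union {P : Program α} {chain : List (Literal α)} {C D : Set (Literal α)}
    (hC : Justified P chain C) (hD : Justified P chain D) (h : Consistent (C ∪ D)) :
    Justified P chain (C ∪ D) where
  consistent := h
  chain_subset := hC.chain_subset.trans Set.subset_union_left
  blocked a := by
    rintro (ha | ha)
    · exact (hC.blocked a ha).imp_right (·.mono Set.subset_union_left)
    · exact (hD.blocked a ha).imp_right (·.mono Set.subset_union_right)
  derivesFrom a := by
    rintro (ha | ha)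
    · exact (hC.derivesFrom a ha).mono (negAtoms_mono Set.subset_union_left) subset_rfl
    · exact (hD.derivesFrom a ha).mono (negAtoms_mono Set.subset_union_right) subset_rfl

theorem Justified.chainSet {P : Program α} {chain : List (Literal α)}
    (h : Consistent (chainSet chain)) : Justified P chain (chainSet chain) :=
  ⟨h, subset_rfl, fun _ ha => .inl ha, fun _ ha => .fact ha⟩

theorem Justified.exists_partialStableModel {P : Program α} {C : Set (Literal α)}
    (hC : Justified P [] C) : ∃ M, IsPartialStableModel P M ∧ C ⊆ M := by
  have hblk : ∀ a ∈ negAtoms C, Blocked P C a := fun a ha => (hC.blocked a ha).resolve_left (by simp)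
  have hder : ∀ a, .pos a ∈ C → Derives P (negAtoms C) a := fun a ha =>
    ((hC.derivesFrom a ha).mono subset_rfl (by simp)).derives
  -- No atom of `negAtoms C` is derivable from default negations that avoid the atoms in `C`.
  have key : ∀ T : Set α, (∀ c ∈ T, .pos c ∉ C) → ∀ a, Derives P T a → a ∉ negAtoms C := by
    intro T hT a h
    induction h with
    | rule r hr _ hneg ih =>
      intro ha
      obtain ⟨b, hb, hbC⟩ | ⟨c, hc, hcC⟩ := hblk _ ha r hr rfl
      · exact ih b hb hbC
      · exact hT c (hneg c hc) hcC
  obtain ⟨S, hS, hfix, hcoh⟩ := exists_altOp_fixpoint P (S₀ := negAtoms C)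
    (fun a ha h => key (negAtoms C) (fun c hc hcC => hC.consistent c ⟨hcC, hc⟩) a h ha)
    (fun a ha h => key (altOp P (negAtoms C)) (fun c hc hcC => hc (hder c hcC)) a h ha)
  refine ⟨{l | (∃ a, l = .pos a ∧ Derives P S a) ∨ ∃ a, l = .neg a ∧ a ∈ S},
    ⟨S, hfix, hcoh, fun a => by simp⟩, ?_⟩
  rintro (a | a) ha
  · exact .inl ⟨a, rfl, (hder a ha).mono hS⟩
  · exact .inr ⟨a, rfl, hS ha⟩

theorem IsPartialStableModel.consistent {P : Program α} {M : Set (Literal α)}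
    (hM : IsPartialStableModel P M) : Consistent M := by
  obtain ⟨S, _, hcoh, h⟩ := hM
  rintro a ⟨hp, hn⟩
  exact hcoh ((h a).2.1 hn) ((h a).1.1 hp)

/-! ### Truth of the completion -/

/-- Truth of `φ` (sign `true`) or of `¬ φ` (sign `false`), with negations pushed to the atoms, when
the true literals are those in `v`. The valuation need not make complementary literals exclusive. -/
def Fml.Holds (v : Literal α → Prop) : Bool → Fml α → Prop
  | true, .fls => False
  | false, .fls => True
  | true, .tru => True
  | false, .tru => False
  | true, .atom a => v (.pos a)
  | false, .atom a => v (.neg a)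
  | true, .neg φ => Fml.Holds v false φ
  | false, .neg φ => Fml.Holds v true φ
  | true, .and φ ψ => Fml.Holds v true φ ∧ Fml.Holds v true ψ
  | false, .and φ ψ => Fml.Holds v false φ ∨ Fml.Holds v false ψ
  | true, .or φ ψ => Fml.Holds v true φ ∨ Fml.Holds v true ψ
  | false, .or φ ψ => Fml.Holds v false φ ∧ Fml.Holds v false ψ

theorem Fml.holds_conj (v : Literal α → Prop) (L : List (Fml α)) :
    Fml.Holds v true (.conj L) ↔ ∀ φ ∈ L, Fml.Holds v true φ := by
  induction L with
  | nil => simp [Fml.conj, Fml.Holds]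
  | cons φ L ih => cases L <;> simp_all [Fml.conj, Fml.Holds]

theorem Fml.holds_not_conj (v : Literal α → Prop) (L : List (Fml α)) :
    Fml.Holds v false (.conj L) ↔ ∃ φ ∈ L, Fml.Holds v false φ := by
  induction L with
  | nil => simp [Fml.conj, Fml.Holds]
  | cons φ L ih => cases L <;> simp_all [Fml.conj, Fml.Holds]

theorem Fml.holds_disj (v : Literal α → Prop) (L : List (Fml α)) :
    Fml.Holds v true (.disj L) ↔ ∃ φ ∈ L, Fml.Holds v true φ := by
  induction L with
  | nil => simp [Fml.disj, Fml.Holds]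
  | cons φ L ih => cases L <;> simp_all [Fml.disj, Fml.Holds]

theorem Fml.holds_not_disj (v : Literal α → Prop) (L : List (Fml α)) :
    Fml.Holds v false (.disj L) ↔ ∀ φ ∈ L, Fml.Holds v false φ := by
  induction L with
  | nil => simp [Fml.disj, Fml.Holds]
  | cons φ L ih => cases L <;> simp_all [Fml.disj, Fml.Holds]

theorem holds_completion (P : Program α) (v : Literal α → Prop) (a : α) :
    (completion P a).Holds v true ↔ ∃ r ∈ P, r.head = a ∧
      (∀ b ∈ r.posBody, v (.pos b)) ∧ ∀ c ∈ r.negBody, v (.neg c) := by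
  simp [completion, Fml.holds_disj, Rule.body, Fml.holds_conj, or_imp, forall_and, Fml.Holds,
    and_assoc]

theorem holds_not_completion (P : Program α) (v : Literal α → Prop) (a : α) :
    (completion P a).Holds v false ↔ ∀ r ∈ P, r.head = a →
      (∃ b ∈ r.posBody, v (.neg b)) ∨ ∃ c ∈ r.negBody, v (.pos c) := by
  simp only [completion, Fml.holds_not_disj, List.forall_mem_map, Finset.mem_toList,
    Finset.mem_filter, and_imp, Rule.body, Fml.holds_not_conj]
  simp [or_and_right, exists_or, Fml.Holds]

/-! ### Loops on rewrite chains -/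

theorem endsInLoop_of_mem {anc : List (Literal α)} {l : Literal α} (h : l ∈ anc) :
    EndsInLoop (anc ++ [l]) := by
  obtain ⟨s, t, rfl⟩ := List.append_of_mem h
  have hsuf : l :: (t ++ [l]) <:+ (s ++ l :: t) ++ [l] := ⟨s, by simp⟩
  have hret : ReturnsToStart (l :: (t ++ [l])) := ⟨l, t, rfl⟩
  by_cases hp : IsPositiveLoop (l :: (t ++ [l]))
  · exact .inl ⟨_, hsuf, .inl hp⟩
  by_cases hn : IsNegativeLoop (l :: (t ++ [l]))
  · exact .inr ⟨_, hsuf, .inl hn⟩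
  · exact .inr ⟨_, hsuf, .inr ⟨hret, hp, hn⟩⟩

theorem endsInLoop_of_compl_mem {anc : List (Literal α)} {l : Literal α} (h : l ∈ anc) :
    EndsInLoop (anc ++ [l.compl]) := by
  obtain ⟨s, t, rfl⟩ := List.append_of_mem h
  exact .inl ⟨l :: (t ++ [l.compl]), ⟨s, by simp⟩, .inr ⟨l, t, rfl⟩⟩

theorem consistent_chainSet_append {anc : List (Literal α)} {l : Literal α}
    (hanc : Consistent (chainSet anc)) (hloop : ¬ EndsInLoop (anc ++ [l])) :
    Consistent (chainSet (anc ++ [l])) := by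
  rintro a ⟨hp, hn⟩
  simp only [chainSet, List.mem_append, List.mem_singleton, Set.mem_ofPred_eq] at hp hn
  rcases hp with hp | rfl <;> rcases hn with hn | hn
  · exact hanc a ⟨hp, hn⟩
  · subst hn
    exact hloop (endsInLoop_of_compl_mem hp)
  · exact hloop (endsInLoop_of_compl_mem hn)
  · cases hn

/-- A final segment `S` of `anc ++ [l]` that returns to its start is `l :: (θ ++ [l])`, and its
part `l :: θ` lies in `anc`. -/
theorem ReturnsToStart.exists_eq {anc S : List (Literal α)} {l : Literal α}
    (h : ReturnsToStart S) (hS : S <:+ anc ++ [l]) :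
    ∃ pre θ, anc = pre ++ l :: θ ∧ S = l :: (θ ++ [l]) := by
  obtain ⟨l', θ, rfl⟩ := h
  obtain ⟨pre, hpre⟩ := hS
  have h' : (pre ++ l' :: θ) ++ [l'] = anc ++ [l] := by simpa using hpre
  obtain ⟨h₁, h₂⟩ := List.append_inj' h' rfl
  obtain rfl : l' = l := by simpa using h₂
  exact ⟨pre, θ, h₁.symm, rfl⟩

/-- The atom `a` occurs on the chain before some negative literal. -/
def Guarded (chain : List (Literal α)) (a : α) : Prop :=
  ∃ pre θ : List (Literal α), chain = pre ++ .pos a :: θ ∧ ∃ b, .neg b ∈ θ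

theorem Guarded.mem {chain : List (Literal α)} {a : α} (h : Guarded chain a) :
    .pos a ∈ chain := by
  obtain ⟨pre, θ, rfl, _⟩ := h
  simp

theorem Guarded.of_append_pos {anc : List (Literal α)} {a b : α}
    (h : Guarded (anc ++ [.pos b]) a) : Guarded anc a := by
  obtain ⟨pre, θ, heq, c, hc⟩ := h
  rcases List.eq_nil_or_concat θ with rfl | ⟨θ', x, rfl⟩
  · simp at hc
  · have h' : anc ++ [.pos b] = (pre ++ .pos a :: θ') ++ [x] := by simpa using heq
    obtain ⟨h₁, h₂⟩ := List.append_inj' h' rfl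
    obtain rfl : Literal.pos b = x := by simpa using h₂
    exact ⟨pre, θ', h₁, c, by simpa using hc⟩

theorem EndsInSucceedingLoop.mem {anc : List (Literal α)} {l : Literal α}
    (h : EndsInSucceedingLoop (anc ++ [l])) : l ∈ anc := by
  obtain ⟨S, hS, h⟩ := h
  obtain ⟨pre, θ, rfl, -⟩ := ReturnsToStart.exists_eq (h.elim (·.1) (·.1)) hS
  simp

theorem EndsInSucceedingLoop.guarded {anc : List (Literal α)} {a : α}
    (h : EndsInSucceedingLoop (anc ++ [.pos a])) : Guarded anc a := by
  obtain ⟨S, hS, h⟩ := h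
  obtain ⟨pre, θ, rfl, rfl⟩ := ReturnsToStart.exists_eq (h.elim (·.1) (·.1)) hS
  rcases h with h | h
  · obtain ⟨b, hb⟩ := h.2 (.pos a) (by simp)
    cases hb
  · by_contra hg
    refine h.2.1 ⟨h.1, fun l hl => ?_⟩
    rcases l with b | b
    · exact ⟨b, rfl⟩
    · exact (hg ⟨pre, θ, rfl, b, by simpa using hl⟩).elim

/-! ### Answers of goals and soundness of rewriting -/

/-- `C` is an answer of the goal: one of the contexts of its disjunctive normal form, where
`L anc l` are the contexts admitted for the occurrence of `l` with ancestors `anc`. -/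
def Goal.Answers (L : List (Literal α) → Literal α → Set (Literal α) → Prop) :
    Goal α → Set (Literal α) → Prop
  | .fls, _ => False
  | .tru D, C => C = D
  | .lit anc l, C => L anc l C
  | .and Φ Ψ, C => ∃ C₁ C₂, Goal.Answers L Φ C₁ ∧ Goal.Answers L Ψ C₂ ∧
      Consistent (C₁ ∪ C₂) ∧ C = C₁ ∪ C₂
  | .or Φ Ψ, C => Goal.Answers L Φ C ∨ Goal.Answers L Ψ C

theorem Goal.IsDisjOfT.answers {L : List (Literal α) → Literal α → Set (Literal α) → Prop}
    {Q : Goal α} {Cs : List (Set (Literal α))} (h : Q.IsDisjOfT Cs) {C : Set (Literal α)}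
    (hC : C ∈ Cs) : Q.Answers L C := by
  induction h with
  | tru D => simpa [Goal.Answers] using hC
  | or _ _ ih₁ ih₂ => exact (List.mem_append.1 hC).imp ih₁ ih₂

theorem Goal.answers_disj_tru {L : List (Literal α) → Literal α → Set (Literal α) → Prop}
    (Ds : List (Set (Literal α))) (f : Set (Literal α) → Set (Literal α)) (C : Set (Literal α)) :
    (Goal.disj (Ds.map fun D => .tru (f D))).Answers L C ↔ ∃ D ∈ Ds, C = f D := by
  induction Ds with
  | nil => simp [Goal.disj, Goal.Answers]
  | cons D Ds ih => cases Ds <;> simp_all [Goal.disj, Goal.Answers]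

theorem Goal.answers_recycled {L : List (Literal α) → Literal α → Set (Literal α) → Prop}
    (chain : List (Literal α)) (Ds : List (Set (Literal α))) (C : Set (Literal α)) :
    (recycled chain Ds).Answers L C ↔
      ∃ D ∈ Ds, Consistent (D ∪ chainSet chain) ∧ C = chainSet chain ∪ D := by
  simp [recycled, Goal.answers_disj_tru, and_assoc]

/-- A property of the contexts admitted for literals at the end of `chain` that is closed under
consistent unions holds of all answers of a formula placed there. -/
theorem Goal.Answers.ofFml_induction
    {L : List (Literal α) → Literal α → Set (Literal α) → Prop} {chain : List (Literal α)}
    {p : Set (Literal α) → Prop} (hlit : ∀ l C, L chain l C → p C) (hchain : p (chainSet chain))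
    (hunion : ∀ C D, p C → p D → Consistent (C ∪ D) → p (C ∪ D)) (φ : Fml α) :
    ∀ (s : Bool) (C : Set (Literal α)), (Goal.ofFml chain s φ).Answers L C → p C := by
  induction φ with
  | fls => rintro (_ | _) C h <;> simp only [Goal.ofFml, Goal.Answers] at h; exact h ▸ hchain
  | tru => rintro (_ | _) C h <;> simp only [Goal.ofFml, Goal.Answers] at h; exact h ▸ hchain
  | atom a => rintro (_ | _) C h <;> exact hlit _ _ h
  | neg φ ih => rintro (_ | _) C h <;> exact ih _ _ h
  | and φ ψ ih₁ ih₂ =>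
    rintro (_ | _) C h
    · exact h.elim (ih₁ _ _) (ih₂ _ _)
    · obtain ⟨C₁, C₂, h₁, h₂, hc, rfl⟩ := h
      exact hunion _ _ (ih₁ _ _ h₁) (ih₂ _ _ h₂) hc
  | or φ ψ ih₁ ih₂ =>
    rintro (_ | _) C h
    · obtain ⟨C₁, C₂, h₁, h₂, hc, rfl⟩ := h
      exact hunion _ _ (ih₁ _ _ h₁) (ih₂ _ _ h₂) hc
    · exact h.elim (ih₁ _ _) (ih₂ _ _)

theorem Goal.Answers.holds_of_ofFml
    {L : List (Literal α) → Literal α → Set (Literal α) → Prop} {chain : List (Literal α)}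
    {v : Literal α → Prop} (φ : Fml α) :
    ∀ (s : Bool) (C : Set (Literal α)), (∀ l, ∀ D ⊆ C, L chain l D → v l) →
      (Goal.ofFml chain s φ).Answers L C → φ.Holds v s := by
  induction φ with
  | fls => rintro (_ | _) C _ h <;> simp_all [Goal.ofFml, Goal.Answers, Fml.Holds]
  | tru => rintro (_ | _) C _ h <;> simp_all [Goal.ofFml, Goal.Answers, Fml.Holds]
  | atom a => rintro (_ | _) C hv h <;> exact hv _ _ subset_rfl h
  | neg φ ih => rintro (_ | _) C hv h <;> exact ih _ _ hv h
  | and φ ψ ih₁ ih₂ =>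
    rintro (_ | _) C hv h
    · exact h.imp (ih₁ _ _ hv) (ih₂ _ _ hv)
    · obtain ⟨C₁, C₂, h₁, h₂, -, rfl⟩ := h
      exact ⟨ih₁ _ _ (fun l D hD => hv l D (hD.trans Set.subset_union_left)) h₁,
        ih₂ _ _ (fun l D hD => hv l D (hD.trans Set.subset_union_right)) h₂⟩
  | or φ ψ ih₁ ih₂ =>
    rintro (_ | _) C hv h
    · obtain ⟨C₁, C₂, h₁, h₂, -, rfl⟩ := h
      exact ⟨ih₁ _ _ (fun l D hD => hv l D (hD.trans Set.subset_union_left)) h₁,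
        ih₂ _ _ (fun l D hD => hv l D (hD.trans Set.subset_union_right)) h₂⟩
    · exact h.imp (ih₁ _ _ hv) (ih₂ _ _ hv)

/-- The literal rewrite rules of `R` are faithful to the partial stable models of `P`: each is the
rule of `R⁰`, or a computed rule whose contexts are justified and among which every partial stable
model containing the literal includes one. -/
def Faithful (P : Program α) (R : RewriteSystem α) : Prop :=
  ∀ l, R l = initialSystem P l ∨ ∃ Ds, R l = .computed Ds ∧
    (∀ D ∈ Ds, l ∈ D ∧ Justified P [] D) ∧
    ∀ M, IsPartialStableModel P M → l ∈ M → ∃ D ∈ Ds, D ⊆ M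

/-- The contexts admitted for an occurrence of `l` below the ancestors `anc`. An atom has to be
derivable without the atoms of the chain that only atoms separate from it: this is what
the failure of positive loops provides, and it lets the atom be discharged from the facts once the
chain is shortened. -/
def Admits (P : Program α) (anc : List (Literal α)) (l : Literal α) (C : Set (Literal α)) :
    Prop :=
  Consistent (chainSet anc) → l ∈ C ∧ Justified P anc C ∧
    ∀ a, l = .pos a → DerivesFrom P (negAtoms C) {b | Guarded anc b} a

theorem Admits.of_ofFml {P : Program α} {anc : List (Literal α)} {l : Literal α}
    {C : Set (Literal α)} (hloop : ¬ EndsInLoop (anc ++ [l])) {φ : Fml α}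
    (hφ : initialSystem P l = .program φ)
    (h : (Goal.ofFml (anc ++ [l]) true φ).Answers (Admits P) C) : Admits P anc l C := by
  intro hanc
  have hcons := consistent_chainSet_append hanc hloop
  have hJ : Justified P (anc ++ [l]) C :=
    h.ofFml_induction (fun l' D hD => (hD hcons).2.1) (.chainSet hcons)
      (fun _ _ => Justified.union)
  have hl : l ∈ C := hJ.chain_subset (by simp [chainSet])
  have hsub : chainSet anc ⊆ C := fun x hx => hJ.chain_subset (by
    rw [chainSet_append_singleton]; exact .inl hx)
  have hholds := h.holds_of_ofFml (v := fun l' => l' ∈ C ∧ ∀ b, l' = .pos b →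
    DerivesFrom P (negAtoms C) {b | Guarded (anc ++ [l]) b} b) _ _ _ (fun l' D hD hA =>
      ⟨hD (hA hcons).1, fun b hb => ((hA hcons).2.2 b hb).mono (negAtoms_mono hD) subset_rfl⟩)
  rcases l with a | a
  · obtain rfl : completion P a = φ := by simpa [initialSystem] using hφ
    obtain ⟨r, hr, rfl, hpos, hneg⟩ := (holds_completion _ _ _).1 hholds
    have hder : DerivesFrom P (negAtoms C) {b | Guarded anc b} r.head :=
      .rule r hr (fun b hb => ((hpos b hb).2 b rfl).mono subset_rfl
        fun _ => Guarded.of_append_pos) (fun c hc => (hneg c hc).1)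
    refine ⟨hl, ⟨hJ.consistent, hsub, fun b hb => ?_, fun b hb => ?_⟩, ?_⟩
    · simpa using hJ.blocked b hb
    · refine (hJ.derivesFrom b hb).trans subset_rfl fun c hc => ?_
      rcases List.mem_append.1 hc with hc | hc
      · exact .fact hc
      · obtain rfl : c = r.head := by simpa using hc
        exact hder.mono subset_rfl fun _ => Guarded.mem
    · rintro b hb
      cases hb
      exact hder
  · obtain rfl : (completion P a).neg = φ := by simpa [initialSystem] using hφ
    have hblk : Blocked P C a := fun r hr ha =>
      ((holds_not_completion P _ a).1 hholds r hr ha).imp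
        (fun ⟨b, hb, h⟩ => ⟨b, hb, h.1⟩) fun ⟨c, hc, h⟩ => ⟨c, hc, h.1⟩
    refine ⟨hl, ⟨hJ.consistent, hsub, fun b hb => ?_, fun b hb => ?_⟩, by simp⟩
    · rcases hJ.blocked b hb with h | h
      · rcases List.mem_append.1 h with h | h
        · exact .inl h
        · obtain rfl : b = a := by simpa using h
          exact .inr hblk
      · exact .inr h
    · simpa using hJ.derivesFrom b hb

theorem Admits.of_recycled {P : Program α} {anc : List (Literal α)} {l : Literal α}
    {D : Set (Literal α)} (hl : l ∈ D) (hD : Justified P [] D)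
    (hcons : Consistent (D ∪ chainSet (anc ++ [l]))) :
    Admits P anc l (chainSet (anc ++ [l]) ∪ D) := by
  have hder : ∀ A : Set α, ∀ a, .pos a ∈ D →
      DerivesFrom P (negAtoms (chainSet (anc ++ [l]) ∪ D)) A a := fun A a ha =>
    (hD.derivesFrom a ha).mono (negAtoms_mono Set.subset_union_right) (by simp)
  have hmem : ∀ x ∈ chainSet (anc ++ [l]) ∪ D, x ∈ anc ∨ x ∈ D := by
    rw [chainSet_append_singleton]
    rintro x ((hx | rfl) | hx)
    exacts [.inl hx, .inr hl, .inr hx]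
  refine fun _ => ⟨.inr hl, ⟨Set.union_comm D _ ▸ hcons, ?_, fun a ha => ?_, fun a ha => ?_⟩, ?_⟩
  · rw [chainSet_append_singleton]
    exact fun x hx => .inl (.inl hx)
  · exact (hmem _ ha).imp_right fun h =>
      ((hD.blocked a h).resolve_left (by simp)).mono Set.subset_union_right
  · exact (hmem _ ha).elim (fun h => .fact h) (hder _ a)
  · rintro a rfl
    exact hder _ a hl

theorem Admits.of_succeedingLoop {P : Program α} {anc : List (Literal α)} {l : Literal α}
    (h : EndsInSucceedingLoop (anc ++ [l])) : Admits P anc l (chainSet (anc ++ [l])) := by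
  have heq : chainSet (anc ++ [l]) = chainSet anc := by
    rw [chainSet_append_singleton, Set.union_eq_self_of_subset_right]
    simpa using show l ∈ chainSet anc from h.mem
  rw [heq]
  refine fun hanc => ⟨h.mem, .chainSet hanc, ?_⟩
  rintro a rfl
  exact .fact h.guarded

/-- Answers are reflected by rewriting. -/
theorem Step.answers {P : Program α} {R : RewriteSystem α} (hR : Faithful P R) {Φ Φ' : Goal α}
    (h : Step R Φ Φ') : ∀ {C}, Φ'.Answers (Admits P) C → Φ.Answers (Admits P) C := by
  induction h with
  | @program anc l φ hloop hl =>
    intro C h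
    refine Admits.of_ofFml hloop ?_ h
    obtain h' | ⟨Ds, h', -⟩ := hR l
    · rw [← h', hl]
    · simp [hl] at h'
  | @rc anc l Ds hloop hl =>
    intro C h
    obtain ⟨D, hD, hcons, rfl⟩ := (Goal.answers_recycled _ _ _).1 h
    obtain h' | ⟨Ds', h', hJ, -⟩ := hR l
    · cases l <;> simp [hl, initialSystem] at h'
    · obtain rfl : Ds = Ds' := by simpa [hl] using h'
      exact Admits.of_recycled (hJ D hD).1 (hJ D hD).2 hcons
  | lr1 => exact False.elim
  | lr2 h =>
    rintro C rfl
    exact Admits.of_succeedingLoop h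
  | sr1 => exact .inr
  | sr1' => exact .inl
  | sr2 => exact False.elim
  | sr2' => exact False.elim
  | sr3 h =>
    rintro C rfl
    exact ⟨_, _, rfl, rfl, h, rfl⟩
  | sr4 => exact False.elim
  | sr5 =>
    rintro C (⟨C₁, C₂, h₁, h₂, h⟩ | ⟨C₁, C₂, h₁, h₂, h⟩)
    exacts [⟨C₁, C₂, h₁, .inl h₂, h⟩, ⟨C₁, C₂, h₁, .inr h₂, h⟩]
  | sr5' =>
    rintro C (⟨C₁, C₂, h₁, h₂, h⟩ | ⟨C₁, C₂, h₁, h₂, h⟩)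
    exacts [⟨C₁, C₂, .inl h₁, h₂, h⟩, ⟨C₁, C₂, .inr h₁, h₂, h⟩]
  | andLeft _ _ ih =>
    rintro C ⟨C₁, C₂, h₁, h₂, h⟩
    exact ⟨C₁, C₂, ih h₁, h₂, h⟩
  | andRight _ _ ih =>
    rintro C ⟨C₁, C₂, h₁, h₂, h⟩
    exact ⟨C₁, C₂, h₁, ih h₂, h⟩
  | orLeft _ _ ih => exact Or.imp_left ih
  | orRight _ _ ih => exact Or.imp_right ih

theorem Rewrites.justified {P : Program α} {R : RewriteSystem α} (hR : Faithful P R)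
    {g : Literal α} {Q : Goal α} {Cs : List (Set (Literal α))} (h : Rewrites R g Q)
    (hQ : Q.IsDisjOfT Cs) {C : Set (Literal α)} (hC : C ∈ Cs) : g ∈ C ∧ Justified P [] C := by
  have hans : (Goal.lit [] g).Answers (Admits P) C := by
    have hQC := hQ.answers (L := Admits P) hC
    clear hQ hC
    unfold Rewrites at h
    generalize Goal.lit [] g = Φ at h ⊢
    induction h using Relation.ReflTransGen.head_induction_on with
    | refl => exact hQC
    | head h _ ih => exact h.answers hR ih
  have := hans (by simp [Consistent, chainSet])
  exact ⟨this.1, this.2.1⟩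

theorem Faithful.isSound {P : Program α} {R : RewriteSystem α} (hR : Faithful P R) :
    IsSound P R := by
  intro g Q Cs h hQ C hC
  obtain ⟨hg, hJ⟩ := h.justified hR hQ hC
  obtain ⟨M, hM, hCM⟩ := hJ.exists_partialStableModel
  exact ⟨M, hM, hg, hCM⟩

/-! ### Truth of goals in a partial stable model -/

/-- The atoms derivable with derivations of height less than `n`. -/
def DerivesWithin (P : Program α) (S : Set α) : ℕ → α → Prop
  | 0, _ => False
  | n + 1, a => ∃ r ∈ P, r.head = a ∧ (∀ b ∈ r.posBody, DerivesWithin P S n b) ∧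
      ∀ c ∈ r.negBody, c ∈ S

theorem DerivesWithin.mono {P : Program α} {S : Set α} {m n : ℕ} (hmn : m ≤ n) {a : α}
    (h : DerivesWithin P S m a) : DerivesWithin P S n a := by
  induction m generalizing n a with
  | zero => exact h.elim
  | succ m ih =>
    obtain ⟨n, rfl⟩ : ∃ k, n = k + 1 := ⟨n - 1, by omega⟩
    obtain ⟨r, hr, ha, hpos, hneg⟩ := h
    exact ⟨r, hr, ha, fun b hb => ih (by omega) (hpos b hb), hneg⟩

theorem Derives.exists_derivesWithin {P : Program α} {S : Set α} {a : α} (h : Derives P S a) :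
    ∃ n, DerivesWithin P S n a := by
  induction h with
  | rule r hr _ hneg ih =>
    choose! f hf using ih
    exact ⟨(r.posBody.map f).sum + 1, r, hr, rfl, fun b hb =>
      (hf b hb).mono (List.single_le_sum (by simp) _ (List.mem_map_of_mem hb)), hneg⟩

/-- Derivable atoms are ranked so that each has a rule whose body atoms have smaller rank. -/
theorem exists_rank (P : Program α) (S : Set α) : ∃ rk : α → ℕ, ∀ a, Derives P S a →
    ∃ r ∈ P, r.head = a ∧ (∀ b ∈ r.posBody, Derives P S b ∧ rk b < rk a) ∧
      ∀ c ∈ r.negBody, c ∈ S := by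
  have hder : ∀ n a, DerivesWithin P S n a → Derives P S a := by
    intro n
    induction n with
    | zero => exact fun _ h => h.elim
    | succ n ih =>
      rintro a ⟨r, hr, rfl, hpos, hneg⟩
      exact .rule r hr (fun b hb => ih b (hpos b hb)) hneg
  refine ⟨fun a => sInf {n | DerivesWithin P S n a}, fun a ha => ?_⟩
  have hmem : DerivesWithin P S (sInf {n | DerivesWithin P S n a}) a :=
    Nat.sInf_mem (s := {n | DerivesWithin P S n a}) ha.exists_derivesWithin
  rcases hn : sInf {n | DerivesWithin P S n a} with _ | n
  · rw [hn] at hmem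
    exact hmem.elim
  · rw [hn] at hmem
    obtain ⟨r, hr, rfl, hpos, hneg⟩ := hmem
    refine ⟨r, hr, rfl, fun b hb => ⟨hder n b (hpos b hb), ?_⟩, hneg⟩
    beta_reduce
    rw [hn]
    exact Nat.lt_succ_of_le (Nat.sInf_le (s := {n | DerivesWithin P S n b}) (hpos b hb))

/-- `y` may follow `x` on a chain that descends a well-founded derivation: from atom to atom, the
rank decreases. -/
def Descends (rk : α → ℕ) (x y : Literal α) : Prop :=
  ∀ a b, x = .pos a → y = .pos b → rk b < rk a

/-- The chain lies in `M` and descends with respect to the rank `rk`. -/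
def Tracks (M : Set (Literal α)) (rk : α → ℕ) (chain : List (Literal α)) : Prop :=
  chainSet chain ⊆ M ∧ chain.IsChain (Descends rk)

theorem Tracks.append {M : Set (Literal α)} {rk : α → ℕ} {anc : List (Literal α)}
    {l l' : Literal α} (h : Tracks M rk (anc ++ [l])) (hl' : l' ∈ M) (hdesc : Descends rk l l') :
    Tracks M rk ((anc ++ [l]) ++ [l']) := by
  refine ⟨?_, List.isChain_append.2 ⟨h.2, by simp, by simpa using hdesc⟩⟩
  rw [chainSet_append_singleton]
  exact Set.union_subset h.1 (by simpa using hl')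

theorem Tracks.not_endsInFailingLoop {M : Set (Literal α)} (hM : Consistent M) {rk : α → ℕ}
    {chain : List (Literal α)} (h : Tracks M rk chain) : ¬ EndsInFailingLoop chain := by
  rintro ⟨S, ⟨pre, rfl⟩, ⟨⟨l, θ, rfl⟩, hpos⟩ | ⟨l, θ, rfl⟩⟩
  · obtain ⟨a, rfl⟩ := hpos l (by simp)
    let rk' : Literal α → ℕ := fun l => l.casesOn rk rk
    have hch : (Literal.pos a :: (θ ++ [.pos a])).IsChain (fun x y => rk' y < rk' x) := by
      refine (List.isChain_append.1 h.2).2.1.imp_of_mem_imp ?_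
      intro x y hx hy hxy
      obtain ⟨b, rfl⟩ := hpos x hx
      obtain ⟨c, rfl⟩ := hpos y hy
      exact hxy b c rfl rfl
    have : IsTrans (Literal α) (fun x y => rk' y < rk' x) := ⟨fun _ _ _ h₁ h₂ => h₂.trans h₁⟩
    have := List.isChain_iff_pairwise.1 hch
    exact lt_irrefl _ (List.rel_of_pairwise_cons this (a' := .pos a) (by simp))
  · have h₁ : l ∈ M := h.1 (by simp [chainSet])
    have h₂ : l.compl ∈ M := h.1 (by simp [chainSet])
    cases l with
    | pos a => exact hM a ⟨h₁, h₂⟩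
    | neg a => exact hM a ⟨h₂, h₁⟩

/-- Truth of a goal in `M`, where an occurrence of a literal is true if its rewrite chain tracks
`M`. -/
def Goal.Holds (M : Set (Literal α)) (rk : α → ℕ) : Goal α → Prop
  | .fls => False
  | .tru C => C ⊆ M
  | .lit anc l => Tracks M rk (anc ++ [l])
  | .and Φ Ψ => Goal.Holds M rk Φ ∧ Goal.Holds M rk Ψ
  | .or Φ Ψ => Goal.Holds M rk Φ ∨ Goal.Holds M rk Ψ

theorem Goal.holds_ofFml {M : Set (Literal α)} {rk : α → ℕ} {chain : List (Literal α)}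
    (hchain : chainSet chain ⊆ M) (φ : Fml α) : ∀ s : Bool,
    (Goal.ofFml chain s φ).Holds M rk ↔ φ.Holds (fun l => Tracks M rk (chain ++ [l])) s := by
  induction φ <;> rintro (_ | _) <;> simp_all [Goal.ofFml, Goal.Holds, Fml.Holds]

theorem Goal.holds_disj {M : Set (Literal α)} {rk : α → ℕ} (L : List (Goal α)) :
    (Goal.disj L).Holds M rk ↔ ∃ Φ ∈ L, Φ.Holds M rk := by
  induction L with
  | nil => simp [Goal.disj, Goal.Holds]
  | cons φ L ih => cases L <;> simp_all [Goal.disj, Goal.Holds]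

theorem Goal.IsDisjOfT.holds_iff {M : Set (Literal α)} {rk : α → ℕ} {Q : Goal α}
    {Cs : List (Set (Literal α))} (h : Q.IsDisjOfT Cs) : Q.Holds M rk ↔ ∃ C ∈ Cs, C ⊆ M := by
  induction h with
  | tru C => simp [Goal.Holds]
  | or _ _ ih₁ ih₂ => simp [Goal.Holds, ih₁, ih₂, or_and_right, exists_or]

/-- In each partial stable model, with a suitable ranking of its atoms, truth of goals is preserved
by rewriting. -/
theorem Faithful.exists_rank_holds {P : Program α} {R : RewriteSystem α} (hR : Faithful P R)
    {M : Set (Literal α)} (hM : IsPartialStableModel P M) :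
    ∃ rk : α → ℕ, ∀ Φ Φ', Step R Φ Φ' → Φ.Holds M rk → Φ'.Holds M rk := by
  have hcons := hM.consistent
  obtain ⟨S, hfix, -, hS⟩ := id hM
  obtain ⟨rk, hrk⟩ := exists_rank P S
  refine ⟨rk, fun Φ Φ' h => ?_⟩
  induction h with
  | @program anc l φ hloop hl =>
    intro h
    have hl' : initialSystem P l = .program φ := by
      obtain h' | ⟨Ds, h', -⟩ := hR l
      · rw [← h', hl]
      · simp [hl] at h'
    have hlM : l ∈ M := h.1 (by simp [chainSet])
    rw [Goal.holds_ofFml h.1]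
    rcases l with a | a
    · obtain rfl : completion P a = φ := by simpa [initialSystem] using hl'
      obtain ⟨r, hr, ha, hpos, hneg⟩ := hrk a ((hS a).1.1 hlM)
      refine (holds_completion _ _ _).2 ⟨r, hr, ha, fun b hb => ?_, fun c hc => ?_⟩
      · refine h.append ((hS b).1.2 (hpos b hb).1) ?_
        rintro _ _ ⟨⟩ ⟨⟩
        exact (hpos b hb).2
      · exact h.append ((hS c).2.2 (hneg c hc)) (by simp [Descends])
    · obtain rfl : (completion P a).neg = φ := by simpa [initialSystem] using hl'
      refine (holds_not_completion _ _ _).2 fun r hr ha => ?_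
      have haS : ¬ Derives P (altOp P S) a := by
        have := (hS a).2.1 hlM
        rwa [← hfix] at this
      by_contra! hcon
      subst ha
      refine haS (.rule r hr (fun b hb => ?_) fun c hc => ?_)
      · by_contra hbS
        refine hcon.1 b hb (h.append ((hS b).2.2 ?_) (by simp [Descends]))
        rw [← hfix]
        exact hbS
      · exact fun hcS => hcon.2 c hc (h.append ((hS c).1.2 hcS) (by simp [Descends]))
  | @rc anc l Ds hloop hl =>
    intro h
    obtain h' | ⟨Ds', h', -, hD⟩ := hR l
    · cases l <;> simp [hl, initialSystem] at h'
    · obtain rfl : Ds = Ds' := by simpa [hl] using h'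
      obtain ⟨D, hD, hDM⟩ := hD M hM (h.1 (by simp [chainSet]))
      refine (Goal.holds_disj _).2 ⟨.tru (chainSet (anc ++ [l]) ∪ D), ?_, Set.union_subset h.1 hDM⟩
      exact List.mem_map.2 ⟨D, List.mem_filter.2
        ⟨hD, by simpa using hcons.mono (Set.union_subset hDM h.1)⟩, rfl⟩
  | lr1 h => exact fun h' => (h'.not_endsInFailingLoop hcons h).elim
  | lr2 => exact fun h => h.1
  | sr1 => exact fun h => h.resolve_left id
  | sr1' => exact fun h => h.resolve_right id
  | sr2 => exact fun h => h.1
  | sr2' => exact fun h => h.2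
  | sr3 => exact fun h => Set.union_subset h.1 h.2
  | sr4 h => exact fun h' => h (hcons.mono (Set.union_subset h'.1 h'.2))
  | sr5 => exact fun h => and_or_left.1 h
  | sr5' => exact fun h => or_and_right.1 h
  | andLeft _ _ ih => exact And.imp_left ih
  | andRight _ _ ih => exact And.imp_right ih
  | orLeft _ _ ih => exact Or.imp_left ih
  | orRight _ _ ih => exact Or.imp_right ih

theorem Rewrites.exists_holds {P : Program α} {R : RewriteSystem α} (hR : Faithful P R)
    {g : Literal α} {Q : Goal α} (h : Rewrites R g Q) {M : Set (Literal α)}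
    (hM : IsPartialStableModel P M) (hg : g ∈ M) : ∃ rk : α → ℕ, Q.Holds M rk := by
  obtain ⟨rk, hrk⟩ := hR.exists_rank_holds hM
  refine ⟨rk, ?_⟩
  induction h with
  | refl => exact ⟨by simpa [chainSet] using hg, by simp⟩
  | tail _ h ih => exact hrk _ _ h ih

/-! ### Existence of normal forms -/

/-- The goal is `F` or a disjunction of goals `T(C)`. -/
def Goal.IsNormal (Q : Goal α) : Prop := Q = .fls ∨ ∃ Cs, Q.IsDisjOfT Cs

/-- The goal can be rewritten to a normal form. -/
def Normalizes (R : RewriteSystem α) (Φ : Goal α) : Prop :=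
  ∃ Q, Relation.ReflTransGen (Step R) Φ Q ∧ Q.IsNormal

theorem Goal.IsNormal.normalizes {R : RewriteSystem α} {Q : Goal α} (h : Q.IsNormal) :
    Normalizes R Q := ⟨Q, .refl, h⟩

theorem Normalizes.of_rewrites {R : RewriteSystem α} {Φ Ψ : Goal α}
    (h : Relation.ReflTransGen (Step R) Φ Ψ) (hΨ : Normalizes R Ψ) : Normalizes R Φ := by
  obtain ⟨Q, hQ, hn⟩ := hΨ
  exact ⟨Q, h.trans hQ, hn⟩

theorem Normalizes.or {R : RewriteSystem α} {Φ Ψ : Goal α} (hΦ : Normalizes R Φ)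
    (hΨ : Normalizes R Ψ) : Normalizes R (.or Φ Ψ) := by
  obtain ⟨Q, hQ, hQn⟩ := hΦ
  obtain ⟨Q', hQ', hQn'⟩ := hΨ
  refine .of_rewrites ((hQ.lift (Goal.or · Ψ) fun _ _ => Step.orLeft Ψ).trans
    (hQ'.lift (Goal.or Q ·) fun _ _ => Step.orRight Q)) ?_
  rcases hQn with rfl | ⟨Cs, hCs⟩
  · exact .of_rewrites (.single (.sr1 _)) hQn'.normalizes
  rcases hQn' with rfl | ⟨Ds, hDs⟩
  · exact .of_rewrites (.single (.sr1' _)) (Goal.IsNormal.normalizes (.inr ⟨Cs, hCs⟩))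
  · exact Goal.IsNormal.normalizes (.inr ⟨_, hCs.or hDs⟩)

theorem Normalizes.and {R : RewriteSystem α} {Φ Ψ : Goal α} (hΦ : Normalizes R Φ)
    (hΨ : Normalizes R Ψ) : Normalizes R (.and Φ Ψ) := by
  obtain ⟨Q, hQ, hQn⟩ := hΦ
  obtain ⟨Q', hQ', hQn'⟩ := hΨ
  refine .of_rewrites ((hQ.lift (Goal.and · Ψ) fun _ _ => Step.andLeft Ψ).trans
    (hQ'.lift (Goal.and Q ·) fun _ _ => Step.andRight Q)) ?_
  rcases hQn with rfl | ⟨Cs, hCs⟩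
  · exact .of_rewrites (.single (.sr2 _)) (Goal.IsNormal.normalizes (.inl rfl))
  rcases hQn' with rfl | ⟨Ds, hDs⟩
  · exact .of_rewrites (.single (.sr2' _)) (Goal.IsNormal.normalizes (.inl rfl))
  clear hQ hQ'
  beta_reduce
  induction hCs with
  | or _ _ ih₁ ih₂ => exact .of_rewrites (.single (.sr5' _ _ _)) (.or ih₁ ih₂)
  | tru C =>
    induction hDs with
    | or _ _ ih₁ ih₂ => exact .of_rewrites (.single (.sr5 _ _ _)) (.or ih₁ ih₂)
    | tru D =>
      by_cases h : Consistent (C ∪ D)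
      · exact .of_rewrites (.single (.sr3 h)) (Goal.IsNormal.normalizes (.inr ⟨_, .tru _⟩))
      · exact .of_rewrites (.single (.sr4 h)) (Goal.IsNormal.normalizes (.inl rfl))

theorem Goal.isNormal_disj_tru (Cs : List (Set (Literal α))) :
    (Goal.disj (Cs.map Goal.tru)).IsNormal := by
  cases Cs with
  | nil => exact .inl rfl
  | cons C Cs =>
    suffices h : ∃ Ds, (Goal.disj ((C :: Cs).map Goal.tru)).IsDisjOfT Ds from .inr h
    induction Cs generalizing C with
    | nil => exact ⟨_, .tru C⟩
    | cons D Cs ih =>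
      obtain ⟨Ds, h⟩ := ih D
      exact ⟨_, .or (.tru C) h⟩

theorem isNormal_recycled (chain : List (Literal α)) (Ds : List (Set (Literal α))) :
    (recycled chain Ds).IsNormal := by
  classical
  have := Goal.isNormal_disj_tru
    ((Ds.filter fun D => Consistent (D ∪ chainSet chain)).map fun D => chainSet chain ∪ D)
  rwa [List.map_map] at this

/-- The atoms of a formula. -/
def Fml.atoms : Fml α → Set α
  | .fls => ∅
  | .tru => ∅
  | .atom a => {a}
  | .neg φ => φ.atoms
  | .and φ ψ => φ.atoms ∪ ψ.atoms
  | .or φ ψ => φ.atoms ∪ ψ.atoms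

theorem Fml.atoms_conj (L : List (Fml α)) : (Fml.conj L).atoms = ⋃ φ ∈ L, φ.atoms := by
  induction L with
  | nil => simp [Fml.conj, Fml.atoms]
  | cons φ L ih => cases L <;> simp_all [Fml.conj, Fml.atoms]

theorem Fml.atoms_disj (L : List (Fml α)) : (Fml.disj L).atoms = ⋃ φ ∈ L, φ.atoms := by
  induction L with
  | nil => simp [Fml.disj, Fml.atoms]
  | cons φ L ih => cases L <;> simp_all [Fml.disj, Fml.atoms]

/-- The literals over the atoms in the bodies of the rules of `P`. -/
def bodyLiterals (P : Program α) : Set (Literal α) :=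
  ⋃ r ∈ P, ⋃ b ∈ r.posBody ++ r.negBody, {.pos b, .neg b}

theorem bodyLiterals_finite (P : Program α) : (bodyLiterals P).Finite := by
  refine Set.Finite.biUnion P.finite_toSet fun r _ => ?_
  exact Set.Finite.biUnion (List.finite_toSet _) fun b _ => by simp

theorem mem_bodyLiterals_of_mem_atoms_completion {P : Program α} {a b : α}
    (hb : b ∈ (completion P a).atoms) : .pos b ∈ bodyLiterals P ∧ .neg b ∈ bodyLiterals P := by
  simp only [completion, Fml.atoms_disj, Rule.body, Set.mem_iUnion, List.mem_map,
    Finset.mem_toList, Finset.mem_filter, exists_prop] at hb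
  obtain ⟨_, ⟨r, ⟨hr, -⟩, rfl⟩, hb⟩ := hb
  have hbr : b ∈ r.posBody ++ r.negBody := by
    simp only [Fml.atoms_conj, Set.mem_iUnion, List.mem_map, List.mem_append, exists_prop] at hb
    obtain ⟨_, ⟨c, hc, rfl⟩ | ⟨c, hc, rfl⟩, hb⟩ := hb
    · obtain rfl : b = c := hb
      exact List.mem_append.2 (.inl hc)
    · obtain rfl : b = c := hb
      exact List.mem_append.2 (.inr hc)
  constructor <;> simp only [bodyLiterals, Set.mem_iUnion, exists_prop] <;>
    exact ⟨r, hr, b, hbr, by simp⟩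

theorem Normalizes.ofFml {R : RewriteSystem α} {chain : List (Literal α)} (φ : Fml α) :
    ∀ s : Bool, (∀ a ∈ φ.atoms, Normalizes R (.lit chain (.pos a)) ∧
      Normalizes R (.lit chain (.neg a))) → Normalizes R (Goal.ofFml chain s φ) := by
  have hfls : Normalizes R .fls := Goal.IsNormal.normalizes (.inl rfl)
  have htru : Normalizes R (.tru (chainSet chain)) := Goal.IsNormal.normalizes (.inr ⟨_, .tru _⟩)
  induction φ with
  | fls => rintro (_ | _) _ <;> assumption
  | tru => rintro (_ | _) _ <;> assumption
  | atom a =>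
    rintro (_ | _) h
    exacts [(h a rfl).2, (h a rfl).1]
  | neg φ ih => rintro (_ | _) h <;> exact ih _ h
  | and φ ψ ih₁ ih₂ =>
    rintro (_ | _) h
    · exact .or (ih₁ _ fun a ha => h a (.inl ha)) (ih₂ _ fun a ha => h a (.inr ha))
    · exact .and (ih₁ _ fun a ha => h a (.inl ha)) (ih₂ _ fun a ha => h a (.inr ha))
  | or φ ψ ih₁ ih₂ =>
    rintro (_ | _) h
    · exact .and (ih₁ _ fun a ha => h a (.inl ha)) (ih₂ _ fun a ha => h a (.inr ha))
    · exact .or (ih₁ _ fun a ha => h a (.inl ha)) (ih₂ _ fun a ha => h a (.inr ha))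

/-- Loop-free chains have no repetitions, so their length is bounded by the number of literals that
can occur; `n` bounds how much the chain can still grow. -/
theorem Faithful.normalizes_lit {P : Program α} {R : RewriteSystem α} (hR : Faithful P R)
    {U : Finset (Literal α)} (hU : bodyLiterals P ⊆ U) (n : ℕ) :
    ∀ (anc : List (Literal α)) (l : Literal α), anc.Nodup → (∀ x ∈ anc, x ∈ U) → l ∈ U →
      U.card < anc.length + n → Normalizes R (.lit anc l) := by
  classical
  induction n with
  | zero =>
    intro anc l hnd hanc _ hlt
    have : anc.toFinset.card ≤ U.card :=
      Finset.card_le_card fun x hx => hanc x (List.mem_toFinset.1 hx)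
    rw [List.toFinset_card_of_nodup hnd] at this
    omega
  | succ n ih =>
    intro anc l hnd hanc hl hlt
    by_cases hloop : EndsInLoop (anc ++ [l])
    · rcases hloop with h | h
      · exact .of_rewrites (.single (.lr1 h)) (Goal.IsNormal.normalizes (.inl rfl))
      · exact .of_rewrites (.single (.lr2 h)) (Goal.IsNormal.normalizes (.inr ⟨_, .tru _⟩))
    have hchild : ∀ l' ∈ bodyLiterals P, Normalizes R (.lit (anc ++ [l]) l') := fun l' hl' => by
      refine ih _ _ ?_ ?_ (hU hl') (by simp only [List.length_append, List.length_singleton]; omega)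
      · rw [← List.concat_eq_append]
        exact hnd.concat fun h => hloop (endsInLoop_of_mem h)
      · intro x hx
        rcases List.mem_append.1 hx with hx | hx
        · exact hanc x hx
        · exact List.mem_singleton.1 hx ▸ hl
    have hprog : ∀ (a : α) (s : Bool),
        Normalizes R (Goal.ofFml (anc ++ [l]) s (completion P a)) := fun a s =>
      Normalizes.ofFml _ s fun b hb =>
        (mem_bodyLiterals_of_mem_atoms_completion hb).imp (hchild _) (hchild _)
    obtain h | ⟨Ds, h, -⟩ := hR l
    · rcases l with a | a
      · exact .of_rewrites (.single (.program hloop h)) (hprog a true)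
      · exact .of_rewrites (.single (.program hloop h)) (hprog a false)
    · exact .of_rewrites (.single (.rc hloop h)) (isNormal_recycled _ _).normalizes

theorem Faithful.isComplete {P : Program α} {R : RewriteSystem α} (hR : Faithful P R) :
    IsComplete P R := by
  intro g M hM hg
  obtain ⟨Q, hQ, hn⟩ : Normalizes R (.lit [] g) := by
    have hfin := (bodyLiterals_finite P).insert g
    refine hR.normalizes_lit (U := hfin.toFinset) (fun x hx => by simp [hx])
      (hfin.toFinset.card + 1) [] g
      List.nodup_nil (by simp) (by simp) ?_
    rw [List.length_nil, zero_add]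
    exact Nat.lt_succ_self _
  obtain ⟨rk, hrk⟩ := Rewrites.exists_holds hR hQ hM hg
  rcases hn with rfl | ⟨Cs, hCs⟩
  · exact hrk.elim
  · obtain ⟨C, hC, hCM⟩ := hCs.holds_iff.1 hrk
    exact ⟨Q, Cs, hQ, hCs, C, hC, (Rewrites.justified hR hQ hCs hC).1, hCM⟩

/-! ### Recycling -/

theorem Faithful.recycling {P : Program α} {R R' : RewriteSystem α} (hR : Faithful P R)
    (h : IsRecyclingOf R R') : Faithful P R' := by
  obtain ⟨L, hL, hL'⟩ := h
  intro l
  by_cases hl : l ∈ L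
  · obtain ⟨Ds, hDs, hl'⟩ := hL l hl
    refine .inr ⟨Ds, hl', ?_⟩
    rcases hDs with ⟨hrw, rfl⟩ | ⟨Q, hrw, hQ⟩
    · refine ⟨by simp, fun M hM hlM => ?_⟩
      obtain ⟨rk, hrk⟩ := hrw.exists_holds hR hM hlM
      exact hrk.elim
    · refine ⟨fun D hD => hrw.justified hR hQ hD, fun M hM hlM => ?_⟩
      obtain ⟨rk, hrk⟩ := hrw.exists_holds hR hM hlM
      exact hQ.holds_iff.1 hrk
  · rw [hL' l hl]
    exact hR l

end LP

theorem theorem2 {α : Type*} (P : LP.Program α) (R : ℕ → LP.RewriteSystem α)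
    (h_zero : R 0 = LP.initialSystem P)
    (h_succ : ∀ i : ℕ, LP.IsRecyclingOf (R i) (R (i + 1))) (i : ℕ) :
    LP.IsSound P (R i) ∧ LP.IsComplete P (R i) := by
  have hR : LP.Faithful P (R i) := by
    induction i with
    | zero => exact fun l => .inl (by rw [h_zero])
    | succ i ih => exact ih.recycling (h_succ i)
  exact ⟨hR.isSound, hR.isComplete⟩
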